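/- Let $(X, \Phi, Y, \Phi^\vee)$ be a reduced root datum with finite set of roots $\Phi \subset X$ and coroots $\Phi^\vee \subset Y$ (write $\beta^\vee$ for the coroot of the root $\beta$), with a chosen base, and assume that it is simply connected, i.e. that the coroots span $Y$ over $\mathbb{Z}$. Let $W$ be its finite Weyl group and let $$W_{\mathrm{aff}} = W \ltimes Y = \{\pi^\mu w : \mu \in Y,\ w \in W\}, \qquad w\,\pi^\mu w^{-1} = \pi^{w\mu},$$ be the affine Weyl group. *Affine roots.* These are the $\beta + n\pi$ with $\beta\in\Phi$, $n\in\mathbb{Z}$; such a root is positive if $\beta>0$ and $n\ge 0$, or $\beta<0$ and $n>0$. Put $s_{\beta+n\pi} = \pi^{n\beta^\vee}s_\beta$ and $\pi^\mu w(\beta+n\pi) = w\beta + (n+\langle\mu,w\beta\rangle)\pi$. The simple affine roots are the simple roots together with $-\theta+\pi$ for the highest root $\theta$ of each irreducible component, and $S$ denotes the set of reflections in the simple affine roots. Let $\ell_{\mathrm{cox}}(x)$ be the least number of factors in an expression of $x$ as a product of elements of $S$ (the Coxeter length). *Length.* Let $\rho$ be the sum of the fundamental weights. For $\mu\in Y$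 choose $v\in W$ with $v\mu$ dominant and set $\ell_{\mathrm{big}}(\pi^\mu w) = 2\langle v\mu,\rho\rangle$. With $\mathrm{Inv}(w^{-1})=\{\beta>0 : w^{-1}\beta<0\}$ set $$\ell_{\mathrm{small}}(\pi^\mu w) = \#\{\beta\in\mathrm{Inv}(w^{-1}) : \langle\mu,\beta\rangle\ge 0\} - \#\{\beta\in\mathrm{Inv}(w^{-1}) : \langle\mu,\beta\rangle<0\}.$$ Let $\ell = \ell_{\mathrm{big}}+\ell_{\mathrm{small}}\,\varepsilon \in \mathbb{Z}\oplus\mathbb{Z}\varepsilon$, and for $t\in\mathbb{R}$ let $\ell_t = \ell_{\mathrm{big}}+t\,\ell_{\mathrm{small}} : W_{\mathrm{aff}}\to\mathbb{R}$ be obtained by setting $\varepsilon=t$. *Claim.* The set $S$ generates $W_{\mathrm{aff}}$, and $\ell_1=\ell_{\mathrm{cox}}$. For every $t\in(0,1]$ the function $\ell_t$ is a grading of the Bruhat order on $W_{\mathrm{aff}}$, that is, $\ell_t(x)<\ell_t(y)$ whenever $x\le y$ and $x\ne y$. This holds for both descriptions of the Bruhat order: the Coxeter-theoretic one, generated by $x\le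 xr$ for conjugates $r$ of elements of $S$ with $\ell_{\mathrm{cox}}(x)<\ell_{\mathrm{cox}}(xr)$, and the one generated by $x\le xs_a$ for positive affine roots $a$ such that $x(a)$ is positive. -/

import Mathlib

namespace AffineBruhat

/-! ### Gradings, word length and the Bruhat order of a group with distinguished generators -/

/-- A map `f` to an ordered set is a grading for a relation `r` (written `≤`) if `x ≤ y` and
`x ≠ y` imply `f x < f y`. -/
def IsGrading {α β : Type*} [LT β] (r : α → α → Prop) (f : α → β) : Prop :=
  ∀ x y, r x y → x ≠ y → f x < f y

/-- The least number of factors in an expression of `g` as a product of elements of `S`. When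
`(G, S)` is a Coxeter system this is the Coxeter length. -/
noncomputable def wordLength {G : Type*} [Group G] (S : Set G) (g : G) : ℕ :=
  sInf {n | ∃ l : List G, (∀ s ∈ l, s ∈ S) ∧ l.prod = g ∧ l.length = n}

/-- The reflections of a Coxeter system: the conjugates of the simple reflections. -/
def IsReflection {G : Type*} [Group G] (S : Set G) (r : G) : Prop :=
  ∃ g : G, ∃ s ∈ S, r = g * s * g⁻¹

/-- The Coxeter-theoretic Bruhat order: the reflexive and transitive relation generated by
`x ≤ x r` for reflections `r` with `ℓ(x) < ℓ(x r)`. -/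
def CoxeterBruhatLE {G : Type*} [Group G] (S : Set G) : G → G → Prop :=
  Relation.ReflTransGen fun x y ↦
    ∃ r, IsReflection S r ∧ y = x * r ∧ wordLength S x < wordLength S y

/-- `wordLength` is the length function of any Coxeter system with simple reflections `S`. -/
theorem wordLength_range_simple {B G : Type*} [Group G] {M : CoxeterMatrix B}
    (cs : CoxeterSystem M G) (g : G) : wordLength (Set.range cs.simple) g = cs.length g := by
  apply le_antisymm
  · obtain ⟨ω, hω, rfl⟩ := cs.exists_isReduced g
    refine Nat.sInf_le ⟨ω.map cs.simple, ?_, rfl, ?_⟩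
    · intro s hs
      obtain ⟨i, -, rfl⟩ := List.mem_map.1 hs
      exact ⟨i, rfl⟩
    · rw [List.length_map, hω.eq]
  · refine le_csInf ⟨_, (cs.exists_isReduced g).choose.map cs.simple, ?_, ?_, rfl⟩ ?_
    · intro s hs
      obtain ⟨i, -, rfl⟩ := List.mem_map.1 hs
      exact ⟨i, rfl⟩
    · exact (cs.exists_isReduced g).choose_spec.2.symm
    · rintro n ⟨l, hl, rfl, rfl⟩
      obtain ⟨ω, rfl⟩ : ∃ ω : List B, ω.map cs.simple = l := by
        rw [← Set.mem_range, Set.range_list_map]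
        exact hl
      rw [List.length_map]
      exact cs.length_wordProd_le ω

/-! ### The affine Weyl group

A split semisimple group (a Kac-Moody group of finite type) is given by its root datum `P`:
`X` is the weight lattice, `Y` is the coweight lattice, `P.root i` are the roots, `P.coroot i` the
coroots, and a base `b` gives the simple roots and coroots. There are finitely many
roots (`Finite ι` below), and all of them are real. -/

section

variable {ι X Y : Type*} [AddCommGroup X] [AddCommGroup Y]

/-- The coweight lattice is the coroot lattice. -/
def IsSimplyConnected (P : RootPairing ι ℤ X Y) : Prop :=
  Submodule.span ℤ (Set.range P.coroot) = ⊤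

/-- The finite Weyl group, in its action on the coweight lattice: `P.flip` has the coroots as its
roots, so that `w • μ` is the action on coweights, and `w • i` is the action on the index set
(of both roots and coroots). -/
abbrev FiniteWeylGroup (P : RootPairing ι ℤ X Y) : Type _ := P.flip.weylGroup

/-- The action on coweights, as a homomorphism to automorphisms of the translation group. -/
noncomputable def translationAction (P : RootPairing ι ℤ X Y) :
    FiniteWeylGroup P →* MulAut (Multiplicative Y) :=
  (MulAutMultiplicative Y).symm.toMonoidHom.comp (DistribMulAction.toAddAut (FiniteWeylGroup P) Y)

/-- The semidirect product of the finite Weyl group and the coweight lattice. The element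
`π ^ μ * w` is `⟨Multiplicative.ofAdd μ, w⟩`. -/
abbrev AffineWeylGroup (P : RootPairing ι ℤ X Y) : Type _ :=
  Multiplicative Y ⋊[translationAction P] FiniteWeylGroup P

/-- The coweight `μ` of `π ^ μ * w`. -/
def coweight {P : RootPairing ι ℤ X Y} (x : AffineWeylGroup P) : Y := x.left.toAdd

theorem mul_eq (P : RootPairing ι ℤ X Y) (μ ν : Y) (w v : FiniteWeylGroup P) :
    (⟨.ofAdd μ, w⟩ * ⟨.ofAdd ν, v⟩ : AffineWeylGroup P) = ⟨.ofAdd (μ + w • ν), w * v⟩ := rfl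

/-! ### Affine roots, reflections and the order defined through them

The pair `(i, n) : ι × ℤ` stands for the affine root `P.root i + n π`. -/

/-- `β + n π` is positive if `β > 0` and `n ≥ 0`, or `β < 0` and `n > 0`. -/
def IsPosAffine {P : RootPairing ι ℤ X Y} (b : P.Base) (a : ι × ℤ) : Prop :=
  (b.IsPos a.1 ∧ 0 ≤ a.2) ∨ (¬ b.IsPos a.1 ∧ 0 < a.2)

/-- The reflection in `β + n π` is `π ^ (n β^∨) * s_β`, with `β^∨` the coroot of `β`. -/
noncomputable def affineReflection (P : RootPairing ι ℤ X Y) (a : ι × ℤ) : AffineWeylGroup P :=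
  ⟨.ofAdd (a.2 • P.coroot a.1), RootPairing.weylGroup.ofIdx P.flip a.1⟩

/-- `π ^ μ * w` sends `β + n π` to `w β + (n + ⟨μ, w β⟩) π`. -/
noncomputable def actAffine {P : RootPairing ι ℤ X Y} (x : AffineWeylGroup P) (a : ι × ℤ) : ι × ℤ :=
  (x.right • a.1, a.2 + P.root' (x.right • a.1) (coweight x))

/-- The Bruhat preorder on the affine Weyl group, generated by `y ≤ y s_a` for positive affine
roots `a` such that `y a` is positive. -/
def BruhatLE {P : RootPairing ι ℤ X Y} (b : P.Base) :
    AffineWeylGroup P → AffineWeylGroup P → Prop :=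
  Relation.ReflTransGen fun y x ↦
    ∃ a : ι × ℤ, IsPosAffine b a ∧ x = y * affineReflection P a ∧ IsPosAffine b (actAffine y a)

/-- A maximal root for the root order; these are the highest roots of the irreducible
components. -/
def IsHighestRoot {P : RootPairing ι ℤ X Y} (b : P.Base) (i : ι) : Prop :=
  ∀ j, P.root j - P.root i ∈ AddSubmonoid.closure (P.root '' b.support) → j = i

/-- The simple affine roots: the simple roots `α`, and `-θ + π` for each highest root `θ`. -/
def IsSimpleAffine {P : RootPairing ι ℤ X Y} (b : P.Base) (a : ι × ℤ) : Prop :=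
  (a.1 ∈ b.support ∧ a.2 = 0) ∨
    (∃ θ, IsHighestRoot b θ ∧ P.root a.1 = -P.root θ ∧ a.2 = 1)

/-- The Coxeter generators of the affine Weyl group. -/
def simpleReflections {P : RootPairing ι ℤ X Y} (b : P.Base) : Set (AffineWeylGroup P) :=
  affineReflection P '' {a | IsSimpleAffine b a}

/-! ### The length function -/

theorem linearIndependent_coroot {P : RootPairing ι ℤ X Y} (b : P.Base) :
    LinearIndependent ℤ fun i : b.support ↦ P.coroot i := b.linearIndepOn_coroot

/-- The simple coroots of a simply connected root datum form a basis of the coweight lattice. -/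
noncomputable def corootBasis {P : RootPairing ι ℤ X Y} (b : P.Base) (h : IsSimplyConnected P) :
    Module.Basis b.support ℤ Y :=
  Module.Basis.mk (linearIndependent_coroot b) (by
    have h2 := b.span_int_coroot_support
    rw [show Submodule.span ℤ (Set.range P.coroot) = ⊤ from h, Set.image_eq_range] at h2
    exact h2.ge)

/-- The fundamental weights, as linear forms on coweights. -/
noncomputable def fundamentalWeight {P : RootPairing ι ℤ X Y} (b : P.Base)
    (h : IsSimplyConnected P) (i : b.support) : Module.Dual ℤ Y :=
  (corootBasis b h).coord i

/-- The sum of the fundamental weights. -/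
noncomputable def rho {P : RootPairing ι ℤ X Y} (b : P.Base) (h : IsSimplyConnected P) :
    Module.Dual ℤ Y :=
  ∑ i, fundamentalWeight b h i

theorem rho_coroot {P : RootPairing ι ℤ X Y} (b : P.Base) (h : IsSimplyConnected P)
    {i : ι} (hi : i ∈ b.support) : rho b h (P.coroot i) = 1 := by
  classical
  have h1 : P.coroot i = corootBasis b h ⟨i, hi⟩ := by
    rw [corootBasis, Module.Basis.mk_apply]
  rw [h1, rho, LinearMap.sum_apply]
  simp [fundamentalWeight, Finsupp.single_apply]

/-- `μ` pairs non-negatively with every simple root. -/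
def IsDominant {P : RootPairing ι ℤ X Y} (b : P.Base) (μ : Y) : Prop :=
  ∀ i ∈ b.support, 0 ≤ P.root' i μ

theorem finite_finiteWeylGroup [Finite ι] {P : RootPairing ι ℤ X Y} (h : IsSimplyConnected P) :
    Finite (FiniteWeylGroup P) := by
  refine Finite.of_injective (β := Equiv.Perm ι) (fun w ↦ P.flip.weylGroupToPerm w) ?_
  intro w v hwv
  apply Subtype.ext
  apply RootPairing.Equiv.weightHom_injective
  apply LinearEquiv.toLinearMap_injective
  refine LinearMap.ext_on_range h fun i ↦ ?_
  have hw := RootPairing.weylGroup_apply_root P.flip w i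
  have hv := RootPairing.weylGroup_apply_root P.flip v i
  have e : P.flip.weylGroupToPerm w = P.flip.weylGroupToPerm v := hwv
  rw [← e, ← hw] at hv
  exact hv.symm

/-- Every coweight is conjugate to a dominant one. -/
theorem exists_isDominant [Finite ι] {P : RootPairing ι ℤ X Y} (b : P.Base)
    (h : IsSimplyConnected P) (μ : Y) : ∃ w : FiniteWeylGroup P, IsDominant b (w • μ) := by
  have := finite_finiteWeylGroup h
  obtain ⟨w, hw⟩ := Finite.exists_max fun w : FiniteWeylGroup P ↦ rho b h (w • μ)
  refine ⟨w, fun i hi ↦ ?_⟩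
  have h1 := hw (RootPairing.weylGroup.ofIdx P.flip i * w)
  have h2 : (RootPairing.weylGroup.ofIdx P.flip i * w) • μ
      = w • μ - P.root' i (w • μ) • P.coroot i := by
    rw [mul_smul]
    exact P.coreflection_apply i (w • μ)
  have h3 : rho b h (P.root' i (w • μ) • P.coroot i) = P.root' i (w • μ) := by
    rw [LinearMap.map_smul, rho_coroot b h hi, smul_eq_mul, mul_one]
  rw [h2, map_sub, h3] at h1
  linarith

/-- `ℓ_big (π ^ μ * w) = ℓ (π ^ μ) = 2 ⟨v μ, ρ⟩`, for `v` in the finite Weyl group such that `v μ`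
is dominant. -/
noncomputable def bigLength [Finite ι] {P : RootPairing ι ℤ X Y} (b : P.Base)
    (h : IsSimplyConnected P) (x : AffineWeylGroup P) : ℤ :=
  2 * rho b h ((exists_isDominant b h (coweight x)).choose • coweight x)

/-- The set of (indices of) positive roots that `w` makes negative. -/
def inversionSet {P : RootPairing ι ℤ X Y} (b : P.Base) (w : FiniteWeylGroup P) : Set ι :=
  {i | b.IsPos i ∧ ¬ b.IsPos (w • i)}

/-- `ℓ_small (π ^ μ * w)`: the number of `β` in the inversion set of `w⁻¹` with `⟨μ, β⟩ ≥ 0`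
minus the number of those with `⟨μ, β⟩ < 0`. -/
noncomputable def smallLength {P : RootPairing ι ℤ X Y} (b : P.Base) (x : AffineWeylGroup P) : ℤ :=
  ({i ∈ inversionSet b x.right⁻¹ | 0 ≤ P.root' i (coweight x)}.ncard : ℤ) -
    ({i ∈ inversionSet b x.right⁻¹ | P.root' i (coweight x) < 0}.ncard : ℤ)

/-- The length `ℓ_big + ℓ_small ε`, with values in `ℤ ⊕ ℤ ε` ordered lexicographically. -/
noncomputable def epsLength [Finite ι] {P : RootPairing ι ℤ X Y} (b : P.Base)
    (h : IsSimplyConnected P) (x : AffineWeylGroup P) : ℤ ×ₗ ℤ :=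
  toLex (bigLength b h x, smallLength b x)

/-- The map `ℤ ⊕ ℤ ε → ℝ` that sets `ε = t`. -/
def evalEps (t : ℝ) (z : ℤ ×ₗ ℤ) : ℝ := ((ofLex z).1 : ℝ) + ((ofLex z).2 : ℝ) * t

/-- The real-valued length `ℓ_t`. -/
noncomputable def realLength [Finite ι] {P : RootPairing ι ℤ X Y} (b : P.Base)
    (h : IsSimplyConnected P) (t : ℝ) (x : AffineWeylGroup P) : ℝ :=
  evalEps t (epsLength b h x)

end

end AffineBruhat

/-!
The affine Weyl group acts on the affine roots, `x s_a x⁻¹ = s_{x a}`, and a simple affine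
reflection makes exactly one positive affine root negative (`IsSimpleAffine.eq_of_not_isPosAffine`;
for `-θ + π` this rests on `⟨β, θ^∨⟩ ∈ {0, 1}` for the positive roots `β ≠ θ`). This gives the
strong exchange condition (`exists_shorter_word`): if `a > 0` and `x a < 0`, omitting a letter from
a word for `x` yields a word for `x s_a`. That the simple affine reflections generate the group,
as the coroots span `Y`, is proved separately (`closure_simpleReflections`). Together they show
that, for `a > 0`, the word length increases from `x` to `x s_a` if and only if `x a > 0`. In
particular, each step of the Coxeter-theoretic Bruhat order is one of the order defined through
affine roots, and only the latter has to be graded.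

Next, `2 ℓ_big (π ^ μ w)` is the sum of `|⟨μ, β⟩|` over all roots `β`, because `2 ρ` is the sum of
the positive roots (`two_mul_bigLength`). It follows that `ℓ_big + ℓ_small` is half the sum of
`|shift b x i|` over all roots, the number of positive affine roots made negative by `x`
(`two_mul_bigLength_add_smallLength`). It increases by one when a reduced word is extended by a
letter, so it is the word length: `ℓ_1 = ℓ_cox`.

Finally, `ℓ_t = (1 - t) ℓ_big + t ℓ_cox`. On a step `x ≤ x s_a` the second summand increases
strictly when `t > 0`, and `ℓ_big` does not decrease: it is a convex Weyl-invariant function of the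
coweight, and the coweight of `x` lies on the segment joining that of `x s_a` to its image under a
reflection (`absSum_le_absSum_add`).
-/

namespace AffineBruhat

section

variable {ι X Y : Type*} [AddCommGroup X] [AddCommGroup Y]

/-! ### The finite Weyl group acting on coweights and on root indices -/

section Finite

variable {P : RootPairing ι ℤ X Y}

theorem ofIdx_smul_index (i j : ι) :
    RootPairing.weylGroup.ofIdx P.flip i • j = P.reflectionPerm i j := rfl

theorem ofIdx_smul_coweight (i : ι) (μ : Y) :
    RootPairing.weylGroup.ofIdx P.flip i • μ = μ - P.root' i μ • P.coroot i := rfl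

theorem smul_coroot (w : FiniteWeylGroup P) (i : ι) : w • P.coroot i = P.coroot (w • i) :=
  RootPairing.weylGroup_apply_root P.flip w i

theorem smul_zsmul_coweight (w : FiniteWeylGroup P) (n : ℤ) (μ : Y) : w • (n • μ) = n • w • μ :=
  map_zsmul (DistribSMul.toAddMonoidHom Y w) n μ

theorem eq_of_forall_smul_coweight_eq {w v : FiniteWeylGroup P} (hwv : ∀ μ : Y, w • μ = v • μ) :
    w = v := by
  apply Subtype.ext
  apply RootPairing.Equiv.weightHom_injective
  apply LinearEquiv.toLinearMap_injective
  exact LinearMap.ext hwv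

theorem root'_reflectionPerm (i j : ι) (μ : Y) :
    P.root' (P.reflectionPerm i j) μ = P.root' j (μ - P.root' i μ • P.coroot i) :=
  LinearMap.congr_fun (P.flip.coroot'_reflectionPerm (i := i) (j := j)) μ

/-- Reflecting a root in itself negates it: throughout, `P.reflectionPerm i i` serves as the index
of the negative of the root of index `i`. -/
theorem root'_reflectionPerm_self (i : ι) (μ : Y) :
    P.root' (P.reflectionPerm i i) μ = -P.root' i μ := by
  rw [root'_reflectionPerm, map_sub, map_smul, RootPairing.root'_coroot_eq_pairing,
    RootPairing.pairing_same, smul_eq_mul]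
  ring

theorem root'_smul (w : FiniteWeylGroup P) (i : ι) (μ : Y) :
    P.root' (w • i) (w • μ) = P.root' i μ := by
  obtain ⟨w, hw⟩ := w
  induction hw using RootPairing.weylGroup.induction generalizing i μ with
  | mem j =>
    change P.root' (P.reflectionPerm j i) (μ - P.root' j μ • P.coroot j) = _
    rw [root'_reflectionPerm]
    simp only [map_sub, map_smul, RootPairing.root'_coroot_eq_pairing, RootPairing.pairing_same,
      smul_eq_mul]
    ring
  | one => rfl
  | mul w v hw hv ihw ihv =>
    exact (ihw ((⟨v, hv⟩ : FiniteWeylGroup P) • i) ((⟨v, hv⟩ : FiniteWeylGroup P) • μ)).trans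
      (ihv i μ)

theorem coroot_reflectionPerm_self (i : ι) :
    P.coroot (P.reflectionPerm i i) = -P.coroot i := by
  simp

theorem root_reflectionPerm_self (i : ι) : P.root (P.reflectionPerm i i) = -P.root i := by
  simp

theorem reflectionPerm_self_self (i : ι) :
    P.reflectionPerm (P.reflectionPerm i i) (P.reflectionPerm i i) = i := by
  apply P.root.injective
  rw [root_reflectionPerm_self, root_reflectionPerm_self, neg_neg]

theorem smul_reflectionPerm_self (w : FiniteWeylGroup P) (i : ι) :
    w • P.reflectionPerm i i = P.reflectionPerm (w • i) (w • i) := by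
  apply P.coroot.injective
  rw [← smul_coroot, coroot_reflectionPerm_self, coroot_reflectionPerm_self, smul_neg, smul_coroot]

theorem mul_ofIdx (w : FiniteWeylGroup P) (i : ι) :
    w * RootPairing.weylGroup.ofIdx P.flip i = RootPairing.weylGroup.ofIdx P.flip (w • i) * w := by
  refine eq_of_forall_smul_coweight_eq fun μ ↦ ?_
  rw [mul_smul, mul_smul, ofIdx_smul_coweight, ofIdx_smul_coweight, smul_sub, smul_zsmul_coweight,
    smul_coroot, root'_smul]

theorem ofIdx_mul_self (i : ι) :
    RootPairing.weylGroup.ofIdx P.flip i * RootPairing.weylGroup.ofIdx P.flip i = 1 := by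
  refine eq_of_forall_smul_coweight_eq fun μ ↦ ?_
  rw [mul_smul, ofIdx_smul_coweight, ofIdx_smul_coweight, one_smul]
  simp only [map_sub, map_smul, RootPairing.root'_coroot_eq_pairing, RootPairing.pairing_same]
  module

theorem ofIdx_reflectionPerm_self (i : ι) :
    RootPairing.weylGroup.ofIdx P.flip (P.reflectionPerm i i) =
      RootPairing.weylGroup.ofIdx P.flip i := by
  refine eq_of_forall_smul_coweight_eq fun μ ↦ ?_
  rw [ofIdx_smul_coweight, ofIdx_smul_coweight, root'_reflectionPerm_self,
    coroot_reflectionPerm_self, neg_smul_neg]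

theorem isPos_reflectionPerm_self (b : P.Base) (i : ι) :
    b.IsPos (P.reflectionPerm i i) ↔ ¬ b.IsPos i :=
  RootPairing.Base.IsPos.neg_iff_not b i

theorem ne_reflectionPerm_self (b : P.Base) (i : ι) : P.reflectionPerm i i ≠ i := by
  intro hi
  have := isPos_reflectionPerm_self b i
  rw [hi] at this
  tauto

theorem pairingIn_eq (i j : ι) : P.pairingIn ℤ i j = P.pairing i j := by
  simpa using P.algebraMap_pairingIn ℤ i j

end Finite

/-! ### The affine Weyl group acting on affine roots -/

section Affine

variable {P : RootPairing ι ℤ X Y}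

theorem coweight_mul (x y : AffineWeylGroup P) :
    coweight (x * y) = coweight x + x.right • coweight y := rfl

theorem coweight_mul_affineReflection (x : AffineWeylGroup P) (a : ι × ℤ) :
    coweight (x * affineReflection P a) = coweight x + a.2 • P.coroot (x.right • a.1) := by
  rw [coweight_mul, ← smul_coroot, ← smul_zsmul_coweight]
  rfl

theorem ext_coweight {x y : AffineWeylGroup P} (h₁ : coweight x = coweight y)
    (h₂ : x.right = y.right) : x = y :=
  SemidirectProduct.ext (Multiplicative.toAdd.injective h₁) h₂

theorem actAffine_one (a : ι × ℤ) : actAffine (1 : AffineWeylGroup P) a = a := by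
  have : coweight (1 : AffineWeylGroup P) = 0 := rfl
  simp [actAffine, this]

theorem actAffine_mul (x y : AffineWeylGroup P) (a : ι × ℤ) :
    actAffine (x * y) a = actAffine x (actAffine y a) := by
  simp only [actAffine, coweight_mul, SemidirectProduct.mul_right, mul_smul, map_add, root'_smul]
  rw [add_assoc, add_comm (P.root' _ (coweight x))]

/-- The negative of an affine root. -/
def negAffine (P : RootPairing ι ℤ X Y) (a : ι × ℤ) : ι × ℤ := (P.reflectionPerm a.1 a.1, -a.2)

theorem actAffine_negAffine (x : AffineWeylGroup P) (a : ι × ℤ) :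
    actAffine x (negAffine P a) = negAffine P (actAffine x a) := by
  simp only [actAffine, negAffine, smul_reflectionPerm_self, root'_reflectionPerm_self]
  rw [neg_add]

theorem affineReflection_negAffine (a : ι × ℤ) :
    affineReflection P (negAffine P a) = affineReflection P a := by
  simp only [affineReflection, negAffine, ofIdx_reflectionPerm_self, coroot_reflectionPerm_self,
    neg_smul_neg]

theorem actAffine_affineReflection_self (a : ι × ℤ) :
    actAffine (affineReflection P a) a = negAffine P a := by
  have h₁ : (affineReflection P a).right • a.1 = P.reflectionPerm a.1 a.1 := rfl
  have h₂ : coweight (affineReflection P a) = a.2 • P.coroot a.1 := rfl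
  rw [actAffine, negAffine, h₁, h₂, root'_reflectionPerm_self, map_smul,
    RootPairing.root'_coroot_eq_pairing, RootPairing.pairing_same, smul_eq_mul]
  congr 1
  ring

theorem mul_affineReflection (x : AffineWeylGroup P) (a : ι × ℤ) :
    x * affineReflection P a = affineReflection P (actAffine x a) * x := by
  apply ext_coweight
  · rw [coweight_mul_affineReflection, coweight_mul]
    change _ = (a.2 + P.root' (x.right • a.1) (coweight x)) • P.coroot (x.right • a.1) +
      RootPairing.weylGroup.ofIdx P.flip (x.right • a.1) • coweight x
    rw [ofIdx_smul_coweight]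
    module
  · exact mul_ofIdx x.right a.1

theorem affineReflection_mul_self (a : ι × ℤ) :
    affineReflection P a * affineReflection P a = 1 := by
  apply ext_coweight
  · rw [coweight_mul_affineReflection]
    change a.2 • P.coroot a.1 + a.2 • P.coroot (P.reflectionPerm a.1 a.1) = 0
    rw [coroot_reflectionPerm_self, smul_neg, add_neg_cancel]
  · exact ofIdx_mul_self a.1

theorem affineReflection_inv (a : ι × ℤ) : (affineReflection P a)⁻¹ = affineReflection P a :=
  inv_eq_of_mul_eq_one_left (affineReflection_mul_self a)

open Classical in
/-- The least `n` such that the affine root `β + n π` is positive, `β` the root of index `i`. -/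
noncomputable def offset (b : P.Base) (i : ι) : ℤ := if b.IsPos i then 0 else 1

theorem offset_of_isPos {b : P.Base} {i : ι} (hi : b.IsPos i) : offset b i = 0 := if_pos hi

theorem offset_of_not_isPos {b : P.Base} {i : ι} (hi : ¬ b.IsPos i) : offset b i = 1 := if_neg hi

theorem offset_reflectionPerm_self (b : P.Base) (i : ι) :
    offset b (P.reflectionPerm i i) = 1 - offset b i := by
  by_cases hi : b.IsPos i
  · rw [offset_of_isPos hi, offset_of_not_isPos (by rwa [isPos_reflectionPerm_self, not_not])]; rfl
  · rw [offset_of_not_isPos hi, offset_of_isPos (by rwa [isPos_reflectionPerm_self])]; rfl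

theorem isPosAffine_iff {b : P.Base} {a : ι × ℤ} : IsPosAffine b a ↔ offset b a.1 ≤ a.2 := by
  by_cases hi : b.IsPos a.1
  · simp [IsPosAffine, hi, offset_of_isPos]
  · simp [IsPosAffine, hi, offset_of_not_isPos, Int.lt_iff_add_one_le]

theorem isPosAffine_negAffine {b : P.Base} {a : ι × ℤ} :
    IsPosAffine b (negAffine P a) ↔ ¬ IsPosAffine b a := by
  rw [isPosAffine_iff, isPosAffine_iff, negAffine, offset_reflectionPerm_self]
  lia

/-- The affine roots parallel to `β` are `β + (offset + k) π` for `k : ℤ`, and such a root is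
positive if and only if `0 ≤ k`. In this coordinate, `x` acts from the affine roots parallel to `β`
to those parallel to `x β` as the translation by `shift b x i`, where `i` is the index of `β`.
Hence `|shift b x i|` is the number of affine roots parallel to `± β` that are positive
with a negative image under `x`. -/
noncomputable def shift (b : P.Base) (x : AffineWeylGroup P) (i : ι) : ℤ :=
  P.root' (x.right • i) (coweight x) + offset b i - offset b (x.right • i)

theorem isPosAffine_actAffine_iff {b : P.Base} {x : AffineWeylGroup P} {a : ι × ℤ} :
    IsPosAffine b (actAffine x a) ↔ 0 ≤ a.2 - offset b a.1 + shift b x a.1 := by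
  rw [isPosAffine_iff, shift]
  change offset b (x.right • a.1) ≤ a.2 + P.root' (x.right • a.1) (coweight x) ↔ _
  constructor <;> intro h <;> linarith

theorem shift_one (b : P.Base) (i : ι) : shift b 1 i = 0 := by
  have : coweight (1 : AffineWeylGroup P) = 0 := rfl
  simp [shift, this]

theorem shift_mul (b : P.Base) (x y : AffineWeylGroup P) (i : ι) :
    shift b (x * y) i = shift b x (y.right • i) + shift b y i := by
  simp only [shift, coweight_mul, SemidirectProduct.mul_right, mul_smul, map_add, root'_smul]
  ring

theorem shift_reflectionPerm_self (b : P.Base) (x : AffineWeylGroup P) (i : ι) :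
    shift b x (P.reflectionPerm i i) = -shift b x i := by
  simp only [shift, smul_reflectionPerm_self, root'_reflectionPerm_self, offset_reflectionPerm_self]
  ring

end Affine

/-! ### Highest roots and simple affine reflections -/

section Simple

variable {P : RootPairing ι ℤ X Y} {b : P.Base}

theorem isPos_induction [Finite ι] {i : ι} (hi : b.IsPos i) {p : X → Prop}
    (h₁ : ∀ j ∈ b.support, p (P.root j))
    (h₂ : ∀ x, ∀ j ∈ b.support, p x → p (x + P.root j)) : p (P.root i) :=
  hi.induction_on_add (p := fun i ↦ p (P.root i)) h₁ fun _ j _ hk hi hj ↦ hk ▸ h₂ _ j hj hi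

theorem root_mem_closure_of_isPos [Finite ι] {i : ι} (hi : b.IsPos i) :
    P.root i ∈ AddSubmonoid.closure (P.root '' b.support) :=
  isPos_induction hi (fun j hj ↦ AddSubmonoid.subset_closure ⟨j, hj, rfl⟩)
    fun _ j hj hx ↦ add_mem hx (AddSubmonoid.subset_closure ⟨j, hj, rfl⟩)

theorem root'_nonneg_of_isDominant [Finite ι] {μ : Y} (hμ : IsDominant b μ) {i : ι}
    (hi : b.IsPos i) : 0 ≤ P.root' i μ :=
  isPos_induction (p := fun x ↦ 0 ≤ P.toLinearMap x μ) hi hμ fun x j hj hx ↦ by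
    rw [map_add]
    exact add_nonneg hx (hμ j hj)

namespace IsHighestRoot

variable {θ : ι} (hθ : IsHighestRoot b θ)

include hθ

theorem isPos [Finite ι] : b.IsPos θ := by
  by_contra h
  have h' := (isPos_reflectionPerm_self b θ).2 h
  refine ne_reflectionPerm_self b θ (hθ _ ?_)
  rw [root_reflectionPerm_self, sub_eq_add_neg, ← root_reflectionPerm_self]
  exact add_mem (root_mem_closure_of_isPos h') (root_mem_closure_of_isPos h')

theorem pairing_nonneg [Finite ι] {i : ι} (hi : b.IsPos i) : 0 ≤ P.pairing i θ := by
  by_contra! h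
  obtain ⟨k, hk⟩ := P.root_add_root_mem_of_pairingIn_neg (i := i) (j := θ)
    (by rwa [pairingIn_eq]) fun hneg ↦ by
      rw [← root_reflectionPerm_self, EmbeddingLike.apply_eq_iff_eq] at hneg
      exact (isPos_reflectionPerm_self b θ).1 (hneg ▸ hi) hθ.isPos
  have hkθ : k = θ := hθ k (by rw [hk, add_sub_cancel_right]; exact root_mem_closure_of_isPos hi)
  rw [hkθ, right_eq_add] at hk
  exact P.ne_zero i hk

theorem not_isPos_of_root_eq_sub [Finite ι] {i k : ι} (hk : P.root k = P.root i - P.root θ) :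
    ¬ b.IsPos k := fun hpos ↦ by
  have hi : i = θ := hθ i (hk ▸ root_mem_closure_of_isPos hpos)
  rw [hi, sub_self] at hk
  exact P.ne_zero k hk

/-- If `⟨β, θ^∨⟩ ≥ 2` for a root `β ≠ θ`, then `θ - β` is a positive root, and the root `-s_θ β`,
which is the sum of `θ - β` and a positive multiple of `θ`, is higher than `θ`. -/
theorem pairing_le_one [Finite ι] {i : ι} (hi : i ≠ θ) : P.pairing i θ ≤ 1 := by
  by_contra! h
  obtain ⟨l, hl⟩ := P.root_sub_root_mem_of_pairingIn_pos (i := i) (j := θ)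
    (by rw [pairingIn_eq]; lia) hi
  have hl' := (isPos_reflectionPerm_self b l).2 (hθ.not_isPos_of_root_eq_sub hl)
  set m := P.reflectionPerm l l with hm
  set k := P.reflectionPerm (P.reflectionPerm θ i) (P.reflectionPerm θ i) with hk
  have hroot : P.root k = P.root m + (P.pairing i θ - 1) • P.root θ := by
    rw [hk, hm, root_reflectionPerm_self, root_reflectionPerm_self, hl,
      RootPairing.root_reflectionPerm, RootPairing.reflection_apply_root]
    module
  have hkθ : k = θ := by
    refine hθ k ?_
    have : P.root k - P.root θ = P.root m + (P.pairing i θ - 2).toNat • P.root θ := by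
      rw [hroot, ← natCast_zsmul, Int.toNat_of_nonneg (by lia)]
      module
    rw [this]
    exact add_mem (root_mem_closure_of_isPos hl')
      (nsmul_mem (root_mem_closure_of_isPos hθ.isPos) _)
  have hh := b.height_add_zsmul hroot
  have h₁ : 0 < b.height m := hl'
  have h₂ : 0 < b.height θ := hθ.isPos
  rw [hkθ, smul_eq_mul] at hh
  nlinarith

theorem shift_affineReflection_of_isPos [Finite ι] {i : ι} (hi : b.IsPos i) (hne : i ≠ θ) :
    P.pairing i θ + offset b i - offset b (P.reflectionPerm θ i) = 0 := by
  have hroot : P.root (P.reflectionPerm θ i) = P.root i - P.pairing i θ • P.root θ := by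
    rw [RootPairing.root_reflectionPerm, RootPairing.reflection_apply_root]
  have h₀ := hθ.pairing_nonneg hi
  have h₁ := hθ.pairing_le_one hne
  obtain h | h : P.pairing i θ = 0 ∨ P.pairing i θ = 1 := by lia
  · rw [h, zero_smul, sub_zero, EmbeddingLike.apply_eq_iff_eq] at hroot
    rw [hroot, h, zero_add, sub_self]
  · rw [h, one_smul] at hroot
    rw [offset_of_not_isPos (hθ.not_isPos_of_root_eq_sub hroot), offset_of_isPos hi, h]
    rfl

end IsHighestRoot

theorem shift_affineReflection (a : ι × ℤ) (i : ι) :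
    shift b (affineReflection P a) i =
      -(a.2 * P.pairing i a.1) + offset b i - offset b (P.reflectionPerm a.1 i) := by
  have h₁ : (affineReflection P a).right • i = P.reflectionPerm a.1 i := rfl
  have h₂ : coweight (affineReflection P a) = a.2 • P.coroot a.1 := rfl
  rw [shift, h₁, h₂, map_smul, RootPairing.root'_coroot_eq_pairing,
    ← RootPairing.pairing_reflectionPerm, RootPairing.pairing_reflectionPerm_self_right,
    smul_eq_mul, mul_neg]

namespace IsSimpleAffine

variable {a : ι × ℤ}

theorem snd_eq_offset [Finite ι] (ha : IsSimpleAffine b a) : a.2 = offset b a.1 := by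
  rcases ha with ⟨h₁, h₂⟩ | ⟨θ, hθ, h₁, h₂⟩
  · rw [h₂, offset_of_isPos (b.isPos_of_mem_support h₁)]
  · rw [← root_reflectionPerm_self, EmbeddingLike.apply_eq_iff_eq] at h₁
    rw [h₂, h₁, offset_reflectionPerm_self, offset_of_isPos hθ.isPos]
    rfl

theorem shift_eq_neg_one [Finite ι] (ha : IsSimpleAffine b a) :
    shift b (affineReflection P a) a.1 = -1 := by
  rw [shift_affineReflection, RootPairing.pairing_same, offset_reflectionPerm_self,
    ha.snd_eq_offset]
  ring

/-- A simple affine reflection permutes the positive affine roots not proportional to the simple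
affine root. -/
theorem shift_eq_zero [Finite ι] [P.IsReduced] (ha : IsSimpleAffine b a) {i : ι} (h₁ : i ≠ a.1)
    (h₂ : i ≠ P.reflectionPerm a.1 a.1) : shift b (affineReflection P a) i = 0 := by
  -- The shift is odd, so it suffices to consider positive roots.
  wlog hi : b.IsPos i generalizing i
  · rw [← neg_eq_zero, ← shift_reflectionPerm_self]
    refine this (fun h ↦ h₂ ?_) (fun h ↦ h₁ ?_) ((isPos_reflectionPerm_self b i).2 hi)
    · rw [← h, reflectionPerm_self_self]
    · rw [← reflectionPerm_self_self (P := P) i, h, reflectionPerm_self_self]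
  rw [shift_affineReflection]
  rcases ha with ⟨h, h'⟩ | ⟨θ, hθ, h, h'⟩
  · rw [h', offset_of_isPos hi, offset_of_isPos (hi.reflectionPerm h h₁)]
    ring
  · rw [← root_reflectionPerm_self, EmbeddingLike.apply_eq_iff_eq] at h
    rw [h, reflectionPerm_self_self] at h₂
    have e : P.reflectionPerm (P.reflectionPerm θ θ) i = P.reflectionPerm θ i := by
      rw [← ofIdx_smul_index, ofIdx_reflectionPerm_self, ofIdx_smul_index]
    rw [h', h, e, RootPairing.pairing_reflectionPerm_self_right, one_mul, neg_neg]
    exact hθ.shift_affineReflection_of_isPos hi h₂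

theorem isPosAffine [Finite ι] (ha : IsSimpleAffine b a) : IsPosAffine b a :=
  isPosAffine_iff.2 ha.snd_eq_offset.ge

/-- The only positive affine root that a simple affine reflection makes negative is the simple
affine root. -/
theorem eq_of_not_isPosAffine [Finite ι] [P.IsReduced] (ha : IsSimpleAffine b a) {c : ι × ℤ}
    (hc : IsPosAffine b c) (hc' : ¬ IsPosAffine b (actAffine (affineReflection P a) c)) :
    c = a := by
  rw [isPosAffine_actAffine_iff] at hc'
  rw [isPosAffine_iff] at hc
  by_cases h₁ : c.1 = a.1
  · rw [h₁, ha.shift_eq_neg_one] at hc'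
    refine Prod.ext h₁ ?_
    rw [ha.snd_eq_offset]
    rw [h₁] at hc
    lia
  · by_cases h₂ : c.1 = P.reflectionPerm a.1 a.1
    · have := ha.shift_eq_neg_one
      rw [h₂, shift_reflectionPerm_self] at hc'
      rw [h₂] at hc
      lia
    · rw [ha.shift_eq_zero h₁ h₂] at hc'
      lia

end IsSimpleAffine

end Simple

/-! ### Formulas for the lengths as sums over all roots -/

section Length

variable {P : RootPairing ι ℤ X Y} {b : P.Base}

/-- The sum over all roots of `|⟨μ, β⟩|`. -/
def absSum [Fintype ι] (P : RootPairing ι ℤ X Y) (μ : Y) : ℤ := ∑ i, |P.root' i μ|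

theorem absSum_smul [Fintype ι] (w : FiniteWeylGroup P) (μ : Y) :
    absSum P (w • μ) = absSum P μ := by
  rw [absSum, ← Equiv.sum_comp (MulAction.toPerm w)]
  simp only [MulAction.toPerm_apply, root'_smul]
  rfl

/-- Both sides take the value `4` on each simple coroot `α^∨`: apart from the roots `± α`,
the reflection `s_α` preserves the sign of a root, and it negates the pairing with `α^∨`. -/
theorem sum_sign_mul_root' [Fintype ι] [P.IsReduced] (h : IsSimplyConnected P) (μ : Y) :
    ∑ i, (1 - 2 * offset b i) * P.root' i μ = 4 * rho b h μ := by
  classical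
  suffices ∑ i, (1 - 2 * offset b i) • P.root' i = (4 : ℤ) • rho b h by
    simpa using LinearMap.congr_fun this μ
  refine (corootBasis b h).ext fun ⟨α, hα⟩ ↦ ?_
  have hb : corootBasis b h ⟨α, hα⟩ = P.coroot α := by rw [corootBasis, Module.Basis.mk_apply]
  rw [hb, LinearMap.smul_apply, rho_coroot b h hα]
  simp only [LinearMap.coe_sum, Finset.sum_apply, LinearMap.smul_apply, smul_eq_mul,
    RootPairing.root'_coroot_eq_pairing]
  have hne := ne_reflectionPerm_self b α
  have h₁ : ∑ i, (1 - 2 * offset b i) * P.pairing i α =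
      ∑ i, -((1 - 2 * offset b (P.reflectionPerm α i)) * P.pairing i α) := by
    rw [← Equiv.sum_comp (P.reflectionPerm α)]
    refine Finset.sum_congr rfl fun i _ ↦ ?_
    rw [← RootPairing.pairing_reflectionPerm, RootPairing.pairing_reflectionPerm_self_right]
    ring
  have ha : IsSimpleAffine b (α, 0) := Or.inl ⟨hα, rfl⟩
  have h₂ : ∀ i, (1 - 2 * offset b i) * P.pairing i α +
      -((1 - 2 * offset b (P.reflectionPerm α i)) * P.pairing i α) =
      (if i = α then 4 else 0) + if i = P.reflectionPerm α α then 4 else 0 := by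
    intro i
    have e : (1 - 2 * offset b i) * P.pairing i α +
        -((1 - 2 * offset b (P.reflectionPerm α i)) * P.pairing i α) =
        -2 * shift b (affineReflection P (α, 0)) i * P.pairing i α := by
      rw [shift_affineReflection]
      ring
    rw [e]
    by_cases hi : i = α
    · rw [if_pos hi, if_neg (by rw [hi]; exact hne.symm), hi, ha.shift_eq_neg_one,
        RootPairing.pairing_same]
      rfl
    · by_cases hi' : i = P.reflectionPerm α α
      · rw [if_neg hi, if_pos hi', hi', shift_reflectionPerm_self, ha.shift_eq_neg_one,
          RootPairing.pairing_reflectionPerm_self_left, RootPairing.pairing_same]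
        rfl
      · rw [if_neg hi, if_neg hi', ha.shift_eq_zero hi hi']
        simp
  have h₃ := Finset.sum_congr rfl fun i (_ : i ∈ Finset.univ) ↦ h₂ i
  rw [Finset.sum_add_distrib, ← h₁, Finset.sum_add_distrib, Finset.sum_ite_eq',
    Finset.sum_ite_eq', if_pos (Finset.mem_univ _), if_pos (Finset.mem_univ _)] at h₃
  linarith

theorem two_mul_bigLength [Fintype ι] [P.IsReduced] (h : IsSimplyConnected P)
    (x : AffineWeylGroup P) : 2 * bigLength b h x = absSum P (coweight x) := by
  have hν := (exists_isDominant b h (coweight x)).choose_spec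
  rw [bigLength, ← absSum_smul (exists_isDominant b h (coweight x)).choose]
  set ν := (exists_isDominant b h (coweight x)).choose • coweight x
  rw [← mul_assoc, show (2 : ℤ) * 2 = 4 from rfl, ← sum_sign_mul_root' h, absSum]
  refine Finset.sum_congr rfl fun i _ ↦ ?_
  by_cases hi : b.IsPos i
  · rw [offset_of_isPos hi, abs_of_nonneg (root'_nonneg_of_isDominant hν hi)]
    ring
  · have hn := root'_nonneg_of_isDominant hν ((isPos_reflectionPerm_self b i).2 hi)
    rw [root'_reflectionPerm_self] at hn
    rw [offset_of_not_isPos hi, abs_of_nonpos (by linarith)]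
    ring

theorem absSum_add_two_mul_smallLength [Fintype ι] (x : AffineWeylGroup P) :
    absSum P (coweight x) + 2 * smallLength b x = ∑ i, |shift b x i| := by
  classical
  -- The contribution of a root to the small length.
  let g : ι → ℤ := fun i ↦
    (if i ∈ {i ∈ inversionSet b x.right⁻¹ | 0 ≤ P.root' i (coweight x)} then 1 else 0) -
      (if i ∈ {i ∈ inversionSet b x.right⁻¹ | P.root' i (coweight x) < 0} then 1 else 0)
  have hg : smallLength b x = ∑ i, g i := by
    rw [smallLength, Finset.sum_sub_distrib, Set.ncard_eq_toFinset_card',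
      Set.ncard_eq_toFinset_card', Finset.sum_boole, Finset.sum_boole, Set.toFinset_ofPred,
      Set.toFinset_ofPred]
    rfl
  have hneg : Function.Involutive fun i ↦ P.reflectionPerm i i := reflectionPerm_self_self
  have hg' : ∑ i, g (P.reflectionPerm i i) = ∑ i, g i := Equiv.sum_comp hneg.toPerm g
  rw [← Equiv.sum_comp (MulAction.toPerm x.right⁻¹), absSum, two_mul, hg]
  nth_rw 1 [← hg']
  rw [← Finset.sum_add_distrib, ← Finset.sum_add_distrib]
  refine Finset.sum_congr rfl fun i _ ↦ ?_
  have e : x.right • x.right⁻¹ • i = i := smul_inv_smul _ _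
  simp only [MulAction.toPerm_apply, shift, e]
  simp only [g, Set.mem_ofPred_eq, inversionSet, root'_reflectionPerm_self,
    isPos_reflectionPerm_self, smul_reflectionPerm_self, offset]
  by_cases h₁ : b.IsPos i <;> by_cases h₂ : b.IsPos (x.right⁻¹ • i) <;>
    simp only [h₁, h₂, not_true_eq_false, not_false_eq_true, and_true, and_false, true_and,
      false_and, if_true, if_false] <;> grind

theorem two_mul_bigLength_add_smallLength [Fintype ι] [P.IsReduced] (h : IsSimplyConnected P)
    (x : AffineWeylGroup P) :
    2 * (bigLength b h x + smallLength b x) = ∑ i, |shift b x i| := by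
  rw [mul_add, two_mul_bigLength, absSum_add_two_mul_smallLength]

/-- Right multiplication by a simple affine reflection `s_a` permutes the numbers `shift b x i`,
apart from those for the indices of `± β`, where `β` is the root parallel to `a`. -/
theorem bigLength_add_smallLength_mul [Finite ι] [P.IsReduced] (h : IsSimplyConnected P)
    {a : ι × ℤ} (ha : IsSimpleAffine b a) {x : AffineWeylGroup P}
    (hx : IsPosAffine b (actAffine x a)) :
    bigLength b h (x * affineReflection P a) + smallLength b (x * affineReflection P a) =
      bigLength b h x + smallLength b x + 1 := by
  classical
  cases nonempty_fintype ι
  suffices ∑ i, |shift b (x * affineReflection P a) i| = ∑ i, |shift b x i| + 2 by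
    rw [← two_mul_bigLength_add_smallLength h, ← two_mul_bigLength_add_smallLength h] at this
    linarith
  set n := P.reflectionPerm a.1 a.1 with hn
  have hne : n ≠ a.1 := ne_reflectionPerm_self b a.1
  rw [isPosAffine_actAffine_iff, ha.snd_eq_offset, sub_self, zero_add] at hx
  have h₁ : ∑ i, |shift b x i| = ∑ i, |shift b x (P.reflectionPerm a.1 i)| :=
    (Equiv.sum_comp (P.reflectionPerm a.1) fun i ↦ |shift b x i|).symm
  have h₂ : ∀ i, |shift b (x * affineReflection P a) i| = |shift b x (P.reflectionPerm a.1 i)| +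
      ((if i = a.1 then 1 else 0) + if i = n then 1 else 0) := by
    intro i
    have e : shift b (x * affineReflection P a) i =
        shift b x (P.reflectionPerm a.1 i) + shift b (affineReflection P a) i := shift_mul b x _ i
    rw [e]
    by_cases hi : i = a.1
    · rw [if_pos hi, if_neg (by rw [hi]; exact hne.symm), hi, ha.shift_eq_neg_one, ← hn,
        hn, shift_reflectionPerm_self, ← neg_add, abs_neg, abs_neg, abs_of_nonneg hx,
        abs_of_nonneg (by linarith), add_zero]
    · by_cases hi' : i = n
      · rw [if_neg hi, if_pos hi', hi', hn, shift_reflectionPerm_self, ha.shift_eq_neg_one,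
          P.reflectionPerm_self, abs_of_nonneg hx, abs_of_nonneg (by linarith)]
        ring
      · rw [if_neg hi, if_neg hi', ha.shift_eq_zero hi hi']
        simp
  rw [h₁, Finset.sum_congr rfl fun i _ ↦ h₂ i, Finset.sum_add_distrib, Finset.sum_add_distrib,
    Finset.sum_ite_eq', Finset.sum_ite_eq', if_pos (Finset.mem_univ _),
    if_pos (Finset.mem_univ _)]
  rfl

/-- The function `absSum` is convex and invariant under reflections. With `ν = μ + k β^∨`
and `m = ⟨μ, β⟩`, one has `(m + 2 k) μ = (m + k) ν + k s_β ν`. -/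
theorem absSum_le_absSum_add [Fintype ι] (μ : Y) (i : ι) {k : ℤ} (hk : 0 ≤ k)
    (hk' : 0 ≤ k + P.root' i μ) : absSum P μ ≤ absSum P (μ + k • P.coroot i) := by
  set m := P.root' i μ with hm
  set ν := μ + k • P.coroot i with hν
  have hs : RootPairing.weylGroup.ofIdx P.flip i • ν = μ - (m + k) • P.coroot i := by
    rw [ofIdx_smul_coweight, hν, map_add, map_smul, RootPairing.root'_coroot_eq_pairing,
      RootPairing.pairing_same, ← hm, smul_eq_mul]
    module
  have hle : (m + 2 * k) * absSum P μ ≤ (m + 2 * k) * absSum P ν := by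
    calc (m + 2 * k) * absSum P μ
        ≤ (m + k) * absSum P ν + k * absSum P (RootPairing.weylGroup.ofIdx P.flip i • ν) := by
          rw [absSum, absSum, absSum, Finset.mul_sum, Finset.mul_sum, Finset.mul_sum,
            ← Finset.sum_add_distrib]
          refine Finset.sum_le_sum fun j _ ↦ ?_
          have e : ∀ {c : ℤ}, 0 ≤ c → ∀ d : ℤ, c * |d| = |c * d| := fun hc d ↦ by
            rw [abs_mul, abs_of_nonneg hc]
          rw [e (show 0 ≤ m + 2 * k by linarith), e (show 0 ≤ m + k by linarith), e hk]
          refine le_trans (le_of_eq ?_) (abs_add_le _ _)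
          rw [hs, hν, map_sub, map_add, map_smul, map_smul, smul_eq_mul, smul_eq_mul]
          congr 1
          ring
      _ = (m + 2 * k) * absSum P ν := by rw [absSum_smul]; ring
  obtain h₀ | h₀ := (show 0 ≤ m + 2 * k by linarith).eq_or_lt
  · have : k = 0 := by linarith
    rw [hν, this, zero_smul, add_zero]
  · exact le_of_mul_le_mul_left hle h₀

theorem bigLength_le_bigLength_mul [Finite ι] [P.IsReduced] (h : IsSimplyConnected P)
    {a : ι × ℤ} (ha : IsPosAffine b a) {x : AffineWeylGroup P}
    (hx : IsPosAffine b (actAffine x a)) :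
    bigLength b h x ≤ bigLength b h (x * affineReflection P a) := by
  cases nonempty_fintype ι
  have hnonneg : ∀ {c : ι × ℤ}, IsPosAffine b c → 0 ≤ c.2 := by
    rintro c (⟨-, hc⟩ | ⟨-, hc⟩)
    · exact hc
    · exact hc.le
  have := absSum_le_absSum_add (P := P) (coweight x) (x.right • a.1) (hnonneg ha) (hnonneg hx)
  rw [← coweight_mul_affineReflection, ← two_mul_bigLength (b := b) h,
    ← two_mul_bigLength h] at this
  linarith

end Length

end

/-! ### Words in a set of involutions -/

section Word

variable {G : Type*} [Group G] {S : Set G}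

theorem wordLength_prod_le {l : List G} (hl : ∀ s ∈ l, s ∈ S) :
    wordLength S l.prod ≤ l.length := Nat.sInf_le ⟨l, hl, rfl, rfl⟩

theorem exists_word (hS : Subgroup.closure S = ⊤) (hinv : ∀ s ∈ S, s⁻¹ = s) (g : G) :
    ∃ l : List G, (∀ s ∈ l, s ∈ S) ∧ l.prod = g ∧ l.length = wordLength S g := by
  have hg : g ∈ Subgroup.closure S := hS ▸ Subgroup.mem_top g
  rw [← Subgroup.mem_toSubmonoid, Subgroup.closure_toSubmonoid] at hg
  obtain ⟨l, hl, rfl⟩ := Submonoid.exists_list_of_mem_closure hg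
  refine Nat.sInf_mem (s := {n | ∃ l' : List G, (∀ s ∈ l', s ∈ S) ∧ l'.prod = l.prod ∧
    l'.length = n}) ⟨_, l, fun s hs ↦ ?_, rfl, rfl⟩
  rcases hl s hs with h | h
  · exact h
  · rw [← inv_inv s, hinv _ h]
    exact h

end Word

section

variable {ι X Y : Type*} [AddCommGroup X] [AddCommGroup Y]
  {P : RootPairing ι ℤ X Y} {b : P.Base}

theorem inv_eq_of_mem_simpleReflections {s : AffineWeylGroup P} (hs : s ∈ simpleReflections b) :
    s⁻¹ = s := by
  obtain ⟨a, -, rfl⟩ := hs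
  exact affineReflection_inv a

/-! ### Generation by the simple affine reflections -/

section Generation

theorem exists_nat_coeff {x : X} (hx : x ∈ AddSubmonoid.closure (P.root '' b.support)) :
    ∃ c : ι → ℕ, x = ∑ j ∈ b.support, c j • P.root j := by
  classical
  induction hx using AddSubmonoid.closure_induction with
  | mem x hx =>
    obtain ⟨j, hj, rfl⟩ := hx
    exact ⟨Pi.single j 1, by simp [Pi.single_apply, ite_smul, Finset.mem_coe.1 hj]⟩
  | zero => exact ⟨0, by simp⟩
  | add x y _ _ hx hy =>
    obtain ⟨c, rfl⟩ := hx
    obtain ⟨d, rfl⟩ := hy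
    exact ⟨c + d, by simp [add_smul, Finset.sum_add_distrib]⟩

theorem height_lt_of_root_sub_mem {i j : ι} (hne : j ≠ i)
    (h : P.root j - P.root i ∈ AddSubmonoid.closure (P.root '' b.support)) :
    b.height i < b.height j := by
  obtain ⟨c, hc⟩ := exists_nat_coeff h
  obtain ⟨f, -, -, hf⟩ := b.exists_root_eq_sum_int i
  have hj : P.root j = ∑ k ∈ b.support, (f k + c k) • P.root k := by
    simp_rw [add_smul, Finset.sum_add_distrib, ← hf, natCast_zsmul, ← hc]
    abel
  rw [RootPairing.Base.height_eq_sum hf, RootPairing.Base.height_eq_sum hj,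
    Finset.sum_add_distrib, lt_add_iff_pos_right]
  refine (Finset.sum_nonneg fun k _ ↦ Int.natCast_nonneg (c k)).lt_of_ne fun h₀ ↦ hne ?_
  have h₁ := (Finset.sum_eq_zero_iff_of_nonneg fun k _ ↦ Int.natCast_nonneg (c k)).1 h₀.symm
  apply P.root.injective
  rw [← sub_eq_zero, hc]
  exact Finset.sum_eq_zero fun k hk ↦ by rw [Int.natCast_eq_zero.1 (h₁ k hk), zero_smul]

theorem two_le_pairing_of_root_sub_mem {i j : ι}
    (hdom : ∀ k ∈ b.support, 0 ≤ P.pairing k i)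
    (h : P.root j - P.root i ∈ AddSubmonoid.closure (P.root '' b.support)) :
    2 ≤ P.pairing j i := by
  obtain ⟨c, hc⟩ := exists_nat_coeff h
  have e : P.pairing j i = 2 + ∑ k ∈ b.support, c k • P.pairing k i := by
    rw [← P.pairing_same i, ← sub_eq_iff_eq_add']
    simpa [P.root_coroot_eq_pairing] using congrArg (fun x ↦ P.toLinearMap x (P.coroot i)) hc
  rw [e]
  exact le_add_of_nonneg_right (Finset.sum_nonneg fun k hk ↦ nsmul_nonneg (hdom k hk) _)

variable [Finite ι] [P.IsReduced]

theorem inr_mem_closure_simpleReflections (b : P.Base) (w : FiniteWeylGroup P) :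
    (SemidirectProduct.inr w : AffineWeylGroup P) ∈ Subgroup.closure (simpleReflections b) := by
  set H := Subgroup.closure (simpleReflections b)
  have hidx : ∀ i : ι, (SemidirectProduct.inr (RootPairing.weylGroup.ofIdx P.flip i) :
      AffineWeylGroup P) ∈ H := by
    intro i
    refine b.induction_reflect (p := fun i ↦ (SemidirectProduct.inr
      (RootPairing.weylGroup.ofIdx P.flip i) : AffineWeylGroup P) ∈ H) i
      (fun i hi ↦ ?_) (fun i hi ↦ ?_) (fun i j hi hj ↦ ?_)
    · rwa [ofIdx_reflectionPerm_self]
    · refine Subgroup.subset_closure ⟨(i, 0), Or.inl ⟨hi, rfl⟩, ext_coweight ?_ rfl⟩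
      exact zero_smul ℤ (P.coroot i)
    · have hj' : (SemidirectProduct.inr (RootPairing.weylGroup.ofIdx P.flip j) :
          AffineWeylGroup P) ∈ H := by
        refine Subgroup.subset_closure ⟨(j, 0), Or.inl ⟨hj, rfl⟩, ext_coweight ?_ rfl⟩
        exact zero_smul ℤ (P.coroot j)
      rw [← ofIdx_smul_index, ← mul_inv_eq_of_eq_mul (mul_ofIdx _ i), map_mul, map_mul, map_inv]
      exact mul_mem (mul_mem hj' hi) (inv_mem hj')
  obtain ⟨w, hw⟩ := w
  induction hw using RootPairing.weylGroup.induction with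
  | mem i => exact hidx i
  | one => exact one_mem H
  | mul w v hw hv ihw ihv =>
    have := mul_mem ihw ihv
    rwa [← map_mul] at this

/-- The translations by coroots are in the subgroup generated by the simple affine reflections.
Otherwise, take a root `β` of maximal height whose coroot does not satisfy this. It pairs
non-negatively with the simple coroots, as reflecting `β` in a simple root cannot raise its height.
It is not a highest root, as `s_{-θ + π} s_θ` is the translation by `-θ^∨`. So there is a higher
root `γ` with `⟨γ, β^∨⟩ ≥ 2`, hence `⟨β, γ^∨⟩ = 1`, and `β^∨ = γ^∨ - s_β γ^∨`. -/
theorem inl_coroot_mem_closure_simpleReflections (b : P.Base) (i : ι) :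
    (SemidirectProduct.inl (.ofAdd (P.coroot i)) : AffineWeylGroup P) ∈
      Subgroup.closure (simpleReflections b) := by
  set H := Subgroup.closure (simpleReflections b) with hH
  let T : ι → Prop := fun i ↦ (SemidirectProduct.inl (.ofAdd (P.coroot i)) : AffineWeylGroup P) ∈ H
  have hT : ∀ (w : FiniteWeylGroup P) (i : ι), T i → T (w • i) := by
    intro w i hi
    have hw := inr_mem_closure_simpleReflections b w
    have := mul_mem (mul_mem hw hi) (inv_mem hw)
    rw [← map_inv, ← SemidirectProduct.inl_aut] at this
    change (SemidirectProduct.inl (.ofAdd (P.coroot (w • i))) : AffineWeylGroup P) ∈ H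
    rw [← smul_coroot]
    exact this
  have hTr : ∀ i j : ι, T (P.reflectionPerm i j) ↔ T j := fun i j ↦
    ⟨fun h ↦ by simpa [ofIdx_smul_index] using hT (RootPairing.weylGroup.ofIdx P.flip i) _ h,
      hT (RootPairing.weylGroup.ofIdx P.flip i) j⟩
  by_contra hi₀
  obtain ⟨i, hi, hmax⟩ := Set.exists_max_image {i | ¬ T i} b.height (Set.toFinite _) ⟨i, hi₀⟩
  have hlt : ∀ j, b.height i < b.height j → T j := fun j hj ↦ by
    by_contra h
    exact absurd (hmax j h) (not_le.2 hj)
  have hpos : b.IsPos i := by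
    by_contra h
    have h₁ := (isPos_reflectionPerm_self b i).2 h
    refine hi ((hTr i i).1 (hlt _ ?_))
    rw [RootPairing.Base.isPos_iff] at h h₁
    lia
  have hdom : ∀ k ∈ b.support, 0 ≤ P.pairing k i := by
    intro k hk
    by_contra! h
    have h' : P.pairing i k < 0 := by
      rw [← pairingIn_eq] at h ⊢
      exact (P.pairingIn_lt_zero_iff ℤ).1 h
    refine hi ((hTr k i).1 (hlt _ ?_))
    have e : P.root (P.reflectionPerm k i) = P.root i + (-P.pairing i k) • P.root k := by
      rw [RootPairing.root_reflectionPerm, RootPairing.reflection_apply_root]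
      module
    rw [b.height_add_zsmul e, RootPairing.Base.height_one_of_mem_support hk, smul_eq_mul]
    linarith
  have hnot : ¬ IsHighestRoot b i := by
    intro hθ
    have h₁ : affineReflection P (P.reflectionPerm i i, 1) ∈ H :=
      Subgroup.subset_closure ⟨_, Or.inr ⟨i, hθ, root_reflectionPerm_self i, rfl⟩, rfl⟩
    have h₂ := mul_mem h₁ (inr_mem_closure_simpleReflections b
      (RootPairing.weylGroup.ofIdx P.flip i))
    have e : affineReflection P (P.reflectionPerm i i, 1) *
        SemidirectProduct.inr (RootPairing.weylGroup.ofIdx P.flip i) =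
        SemidirectProduct.inl (.ofAdd (P.coroot (P.reflectionPerm i i))) := by
      apply ext_coweight
      · change (1 : ℤ) • P.coroot (P.reflectionPerm i i) +
          RootPairing.weylGroup.ofIdx P.flip (P.reflectionPerm i i) • (0 : Y) = _
        rw [smul_zero, one_smul, add_zero]
        rfl
      · change RootPairing.weylGroup.ofIdx P.flip (P.reflectionPerm i i) *
          RootPairing.weylGroup.ofIdx P.flip i = 1
        rw [ofIdx_reflectionPerm_self, ofIdx_mul_self]
    rw [e] at h₂
    exact hi ((hTr i i).1 h₂)
  simp only [IsHighestRoot, not_forall] at hnot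
  obtain ⟨j, hj, hne⟩ := hnot
  have hTj : T j := hlt j (height_lt_of_root_sub_mem hne hj)
  have h₂ := two_le_pairing_of_root_sub_mem hdom hj
  have h₁ : P.pairing i j = 1 := by
    have := P.pairingIn_pairingIn_mem_set_of_isCrystal_of_isRed' j i
      (fun h ↦ hne (P.root.injective h)) (fun h ↦ by
        rw [← root_reflectionPerm_self, EmbeddingLike.apply_eq_iff_eq] at h
        rw [h, RootPairing.pairing_reflectionPerm_self_left, RootPairing.pairing_same] at h₂
        lia)
    simp only [pairingIn_eq, Set.mem_insert_iff, Set.mem_singleton_iff, Prod.mk.injEq] at this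
    lia
  have e : P.coroot i = P.coroot j - P.coroot (P.reflectionPerm i j) := by
    rw [P.coroot_reflectionPerm, P.coreflection_apply_coroot, h₁]
    module
  refine hi ?_
  change (SemidirectProduct.inl (.ofAdd (P.coroot i)) : AffineWeylGroup P) ∈ H
  rw [e, ofAdd_sub, map_div]
  exact div_mem hTj ((hTr i j).2 hTj)

theorem closure_simpleReflections (b : P.Base) (h : IsSimplyConnected P) :
    Subgroup.closure (simpleReflections b) = ⊤ := by
  set H := Subgroup.closure (simpleReflections b)
  have hinl : ∀ μ : Y, (SemidirectProduct.inl (.ofAdd μ) : AffineWeylGroup P) ∈ H := by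
    intro μ
    have hmem : μ ∈ Submodule.span ℤ (Set.range P.coroot) :=
      (show Submodule.span ℤ (Set.range P.coroot) = ⊤ from h) ▸ Submodule.mem_top
    induction hmem using Submodule.span_induction with
    | mem μ hμ =>
      obtain ⟨i, rfl⟩ := hμ
      exact inl_coroot_mem_closure_simpleReflections b i
    | zero => exact one_mem _
    | add μ ν _ _ hμ hν =>
      rw [ofAdd_add, map_mul]
      exact mul_mem hμ hν
    | smul n μ _ hμ =>
      rw [ofAdd_zsmul, map_zpow]
      exact zpow_mem hμ n
  refine (Subgroup.eq_top_iff' H).2 fun x ↦ ?_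
  rw [← SemidirectProduct.inl_left_mul_inr_right x]
  exact mul_mem (hinl (coweight x)) (inr_mem_closure_simpleReflections b _)

end Generation

/-! ### The exchange condition and the Coxeter length -/

section Exchange

variable [Finite ι] [P.IsReduced]

/-- The strong exchange condition. The letter to be omitted is the one at which the image of `a`
under the final segments of the word becomes negative. -/
theorem exists_shorter_word {l : List (AffineWeylGroup P)} (hl : ∀ s ∈ l, s ∈ simpleReflections b)
    {a : ι × ℤ} (ha : IsPosAffine b a) (hla : ¬ IsPosAffine b (actAffine l.prod a)) :
    ∃ l' : List (AffineWeylGroup P), (∀ s ∈ l', s ∈ simpleReflections b) ∧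
      l'.prod = l.prod * affineReflection P a ∧ l'.length + 1 = l.length := by
  induction l with
  | nil =>
    rw [List.prod_nil, actAffine_one] at hla
    exact absurd ha hla
  | cons s l ih =>
    have hl' : ∀ t ∈ l, t ∈ simpleReflections b := fun t ht ↦ hl t (List.mem_cons_of_mem s ht)
    have hs : s ∈ simpleReflections b := hl s List.mem_cons_self
    by_cases h : IsPosAffine b (actAffine l.prod a)
    · obtain ⟨c, hc, rfl⟩ := hs
      rw [List.prod_cons, actAffine_mul] at hla
      have hca := IsSimpleAffine.eq_of_not_isPosAffine hc h hla
      refine ⟨l, hl', ?_, rfl⟩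
      rw [List.prod_cons, mul_assoc, mul_affineReflection, hca, ← mul_assoc,
        affineReflection_mul_self, one_mul]
    · obtain ⟨l', h₁, h₂, h₃⟩ := ih hl' h
      refine ⟨s :: l', fun t ht ↦ ?_, ?_, ?_⟩
      · rcases List.mem_cons.1 ht with rfl | ht
        · exact hs
        · exact h₁ t ht
      · rw [List.prod_cons, List.prod_cons, h₂, mul_assoc]
      · rw [List.length_cons, List.length_cons, h₃]

theorem wordLength_mul_lt (h : IsSimplyConnected P) {x : AffineWeylGroup P} {a : ι × ℤ}
    (ha : IsPosAffine b a) (hx : ¬ IsPosAffine b (actAffine x a)) :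
    wordLength (simpleReflections b) (x * affineReflection P a) <
      wordLength (simpleReflections b) x := by
  obtain ⟨l, hl, rfl, hlen⟩ := exists_word (closure_simpleReflections b h)
    (fun _ ↦ inv_eq_of_mem_simpleReflections) x
  obtain ⟨l', h₁, h₂, h₃⟩ := exists_shorter_word hl ha hx
  rw [← h₂, ← hlen, ← h₃]
  exact Nat.lt_succ_of_le (wordLength_prod_le h₁)

theorem wordLength_lt_mul (h : IsSimplyConnected P) {x : AffineWeylGroup P} {a : ι × ℤ}
    (ha : IsPosAffine b a) (hx : IsPosAffine b (actAffine x a)) :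
    wordLength (simpleReflections b) x <
      wordLength (simpleReflections b) (x * affineReflection P a) := by
  have := wordLength_mul_lt h (x := x * affineReflection P a) ha (by
    rwa [actAffine_mul, actAffine_affineReflection_self, actAffine_negAffine,
      isPosAffine_negAffine, not_not])
  rwa [mul_assoc, affineReflection_mul_self, mul_one] at this

theorem bigLength_add_smallLength_eq_wordLength (h : IsSimplyConnected P) (x : AffineWeylGroup P) :
    bigLength b h x + smallLength b x = wordLength (simpleReflections b) x := by
  obtain ⟨l, hl, rfl, hlen⟩ := exists_word (closure_simpleReflections b h)
    (fun _ ↦ inv_eq_of_mem_simpleReflections) x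
  rw [← hlen]
  -- The value at the product of a reduced word grows by one with each letter.
  induction l using List.reverseRecOn with
  | nil =>
    cases nonempty_fintype ι
    have := two_mul_bigLength_add_smallLength (b := b) h 1
    simp only [shift_one, abs_zero, Finset.sum_const_zero] at this
    simpa using this
  | append_singleton l s ih =>
    have hl' : ∀ t ∈ l, t ∈ simpleReflections b := fun t ht ↦ hl t (List.mem_append_left _ ht)
    obtain ⟨a, ha, rfl⟩ := hl s (by simp)
    rw [List.prod_append, List.prod_singleton, List.length_append, List.length_singleton] at hlen ⊢
    have hle := wordLength_prod_le hl'
    have hpos : IsPosAffine b (actAffine l.prod a) := by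
      by_contra hneg
      have := wordLength_mul_lt h (IsSimpleAffine.isPosAffine ha) hneg
      lia
    have hlen' : l.length = wordLength (simpleReflections b) l.prod := by
      refine le_antisymm ?_ hle
      obtain ⟨l', h₁, h₂, h₃⟩ := exists_word (closure_simpleReflections b h)
        (fun _ ↦ inv_eq_of_mem_simpleReflections) l.prod
      have := wordLength_prod_le (l := l' ++ [affineReflection P a]) fun t ht ↦ by
        rcases List.mem_append.1 ht with ht | ht
        · exact h₁ t ht
        · exact List.mem_singleton.1 ht ▸ ⟨a, ha, rfl⟩
      rw [List.prod_append, List.prod_singleton, List.length_append, List.length_singleton,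
        h₂, h₃] at this
      lia
    rw [bigLength_add_smallLength_mul h ha hpos, ih hl' hlen', Nat.cast_succ]

end Exchange

/-! ### The Bruhat order -/

section Bruhat

variable [Finite ι] [P.IsReduced]

theorem realLength_eq (h : IsSimplyConnected P) (t : ℝ) (x : AffineWeylGroup P) :
    realLength b h t x = (1 - t) * bigLength b h x +
      t * wordLength (simpleReflections b) x := by
  have e : (wordLength (simpleReflections b) x : ℝ) = bigLength b h x + smallLength b x := by
    exact_mod_cast (bigLength_add_smallLength_eq_wordLength h x).symm
  rw [e]
  change (bigLength b h x : ℝ) + (smallLength b x : ℝ) * t = _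
  ring

theorem realLength_lt_mul (h : IsSimplyConnected P) {t : ℝ} (h₀ : 0 < t) (h₁ : t ≤ 1)
    {x : AffineWeylGroup P} {a : ι × ℤ} (ha : IsPosAffine b a)
    (hx : IsPosAffine b (actAffine x a)) :
    realLength b h t x < realLength b h t (x * affineReflection P a) := by
  rw [realLength_eq, realLength_eq]
  refine add_lt_add_of_le_of_lt ?_ ?_
  · exact mul_le_mul_of_nonneg_left (by exact_mod_cast bigLength_le_bigLength_mul h ha hx)
      (sub_nonneg.2 h₁)
  · exact mul_lt_mul_of_pos_left (by exact_mod_cast wordLength_lt_mul h ha hx) h₀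

theorem isGrading_bruhatLE (h : IsSimplyConnected P) {t : ℝ} (h₀ : 0 < t) (h₁ : t ≤ 1) :
    IsGrading (BruhatLE b) (realLength b h t) := by
  have hle : ∀ x y, BruhatLE b x y → x = y ∨ realLength b h t x < realLength b h t y := by
    intro x y hxy
    induction hxy with
    | refl => exact Or.inl rfl
    | tail _ hyz ih =>
      obtain ⟨a, ha, rfl, hx⟩ := hyz
      have hlt := realLength_lt_mul h h₀ h₁ ha hx
      rcases ih with rfl | ih
      · exact Or.inr hlt
      · exact Or.inr (ih.trans hlt)
  exact fun x y hxy hne ↦ (hle x y hxy).resolve_left hne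

/-- A conjugate of a simple affine reflection is the reflection in a positive affine root `a`, and
it lengthens `x` only if `x a` is positive. -/
theorem bruhatLE_of_coxeterBruhatLE (h : IsSimplyConnected P) {x y : AffineWeylGroup P}
    (hxy : CoxeterBruhatLE (simpleReflections b) x y) : BruhatLE b x y := by
  refine Relation.ReflTransGen.mono ?_ x y hxy
  rintro x _ ⟨r, ⟨g, s, ⟨c, -, rfl⟩, rfl⟩, rfl, hlt⟩
  rw [mul_affineReflection, mul_inv_cancel_right] at hlt ⊢
  obtain ⟨a, ha, hac⟩ : ∃ a, IsPosAffine b a ∧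
      affineReflection P a = affineReflection P (actAffine g c) := by
    by_cases hpos : IsPosAffine b (actAffine g c)
    · exact ⟨_, hpos, rfl⟩
    · exact ⟨_, isPosAffine_negAffine.2 hpos, affineReflection_negAffine _⟩
  rw [← hac] at hlt ⊢
  refine ⟨a, ha, rfl, ?_⟩
  by_contra hneg
  exact absurd (wordLength_mul_lt h ha hneg) hlt.not_gt

end Bruhat

end

end AffineBruhat

theorem mainTheorem6 {ι X Y : Type*} [Finite ι] [AddCommGroup X] [AddCommGroup Y]
    (P : RootPairing ι ℤ X Y) [P.IsReduced] (b : P.Base)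
    (h : AffineBruhat.IsSimplyConnected P) :
    Subgroup.closure (AffineBruhat.simpleReflections b) = ⊤ ∧
    (∀ x : AffineBruhat.AffineWeylGroup P, AffineBruhat.realLength b h 1 x =
      (AffineBruhat.wordLength (AffineBruhat.simpleReflections b) x : ℝ)) ∧
    ∀ t : ℝ, 0 < t → t ≤ 1 →
      AffineBruhat.IsGrading (AffineBruhat.CoxeterBruhatLE (AffineBruhat.simpleReflections b))
        (AffineBruhat.realLength b h t) ∧
      AffineBruhat.IsGrading (AffineBruhat.BruhatLE b) (AffineBruhat.realLength b h t) := by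
  refine ⟨AffineBruhat.closure_simpleReflections b h, fun x ↦ ?_, fun t h₀ h₁ ↦ ?_⟩
  · rw [AffineBruhat.realLength_eq, sub_self, zero_mul, zero_add, one_mul]
  · have hgrad := AffineBruhat.isGrading_bruhatLE (b := b) h h₀ h₁
    exact ⟨fun x y hxy ↦ hgrad x y (AffineBruhat.bruhatLE_of_coxeterBruhatLE h hxy), hgrad⟩
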